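/- Let $\mathbb{K}$ be a field. A Leibniz algebra over $\mathbb{K}$ is a $\mathbb{K}$-vector space $\mathfrak{g}$ (of any dimension) with a $\mathbb{K}$-bilinear bracket satisfying $[x,[y,z]]=[[x,y],z]-[[x,z],y]$ for all $x,y,z\in\mathfrak{g}$. Its center is the two-sided ideal $Z(\mathfrak{g})=\{c\in\mathfrak{g} : [x,c]=0=[c,x]\ \text{for all } x\in\mathfrak{g}\}$. It is called perfect if $\mathfrak{g}=[\mathfrak{g},\mathfrak{g}]$, where $[\mathfrak{g},\mathfrak{g}]$ is the linear span of all brackets $[x,y]$, $x,y\in\mathfrak{g}$, and capable if there is a Leibniz algebra $\mathfrak{q}$ over $\mathbb{K}$ with an isomorphism of Leibniz algebras $\mathfrak{g}\cong\mathfrak{q}/Z(\mathfrak{q})$. Let $\mathfrak{g}$ be a perfect Leibniz algebra over $\mathbb{K}$. Then $\mathfrak{g}$ is capable if and only if $Z(\mathfrak{g})=0$. -/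

import Mathlib

universe u v w

/-- The ring-level data of a (right) Leibniz algebra: an additive group with a biadditive bracket
satisfying the Leibniz identity `[x, [y, z]] = [[x, y], z] - [[x, z], y]`. -/
class LeibnizRing (g : Type*) extends AddCommGroup g, Bracket g g where
  protected add_bracket : ∀ x y z : g, ⁅x + y, z⁆ = ⁅x, z⁆ + ⁅y, z⁆
  protected bracket_add : ∀ x y z : g, ⁅x, y + z⁆ = ⁅x, y⁆ + ⁅x, z⁆
  protected leibniz : ∀ x y z : g, ⁅x, ⁅y, z⁆⁆ = ⁅⁅x, y⁆, z⁆ - ⁅⁅x, z⁆, y⁆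

/-- A Leibniz algebra over a field `K`: a `K`-vector space with a `K`-bilinear bracket satisfying
the Leibniz identity. -/
class LeibnizAlgebra (K : Type*) (g : Type*) [Field K] [LeibnizRing g] extends Module K g where
  protected smul_bracket : ∀ (k : K) (x y : g), ⁅k • x, y⁆ = k • ⁅x, y⁆
  protected bracket_smul : ∀ (k : K) (x y : g), ⁅x, k • y⁆ = k • ⁅x, y⁆

/-- A two-sided ideal of a Leibniz algebra. -/
structure LeibnizIdeal (K : Type*) (g : Type*) [Field K] [LeibnizRing g] [LeibnizAlgebra K g]
    extends Submodule K g where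
  bracket_mem_left : ∀ a ∈ carrier, ∀ x : g, ⁅a, x⁆ ∈ carrier
  bracket_mem_right : ∀ a ∈ carrier, ∀ x : g, ⁅x, a⁆ ∈ carrier

/-- An isomorphism of Leibniz algebras: a linear bijection preserving the bracket. -/
structure LeibnizEquiv (K : Type*) (g h : Type*) [Field K] [LeibnizRing g] [LeibnizAlgebra K g]
    [LeibnizRing h] [LeibnizAlgebra K h] extends g ≃ₗ[K] h where
  map_bracket : ∀ x y : g, toFun ⁅x, y⁆ = ⁅toFun x, toFun y⁆

namespace LeibnizAlgebra

section Basic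

variable (K : Type*) {g : Type*} [Field K] [LeibnizRing g] [LeibnizAlgebra K g]

/-- The bracket as a bilinear map. -/
def bracketₗ : g →ₗ[K] g →ₗ[K] g :=
  LinearMap.mk₂ K (fun x y => ⁅x, y⁆) LeibnizRing.add_bracket LeibnizAlgebra.smul_bracket
    LeibnizRing.bracket_add LeibnizAlgebra.bracket_smul

variable {K}

/-- The bracket induced on the quotient by an ideal, `[x + I, y + I] = [x, y] + I`. -/
def quotientBracket (I : LeibnizIdeal K g) :
    (g ⧸ I.toSubmodule) →ₗ[K] (g ⧸ I.toSubmodule) →ₗ[K] (g ⧸ I.toSubmodule) :=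
  I.toSubmodule.liftQ
    { toFun := fun x => I.toSubmodule.mapQ I.toSubmodule (bracketₗ K x)
        (fun a ha => I.bracket_mem_right a ha x)
      map_add' := fun x x' => by
        ext y
        exact congrArg (Submodule.Quotient.mk (p := I.toSubmodule))
          (LeibnizRing.add_bracket x x' y)
      map_smul' := fun k x => by
        ext y
        exact congrArg (Submodule.Quotient.mk (p := I.toSubmodule))
          (LeibnizAlgebra.smul_bracket k x y) }
    (fun a ha => by
      ext y
      exact (Submodule.Quotient.mk_eq_zero _).2 (I.bracket_mem_left a ha y))

instance quotientLeibnizRing (I : LeibnizIdeal K g) : LeibnizRing (g ⧸ I.toSubmodule) where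
  bracket x y := quotientBracket I x y
  add_bracket x y z := by
    change quotientBracket I (x + y) z = quotientBracket I x z + quotientBracket I y z
    simp
  bracket_add x y z := map_add (quotientBracket I x) y z
  leibniz x y z := by
    induction x using Submodule.Quotient.induction_on with | _ x =>
    induction y using Submodule.Quotient.induction_on with | _ y =>
    induction z using Submodule.Quotient.induction_on with | _ z =>
    exact congrArg (Submodule.Quotient.mk (p := I.toSubmodule)) (LeibnizRing.leibniz x y z)

instance quotientLeibnizAlgebra (I : LeibnizIdeal K g) :
    LeibnizAlgebra K (g ⧸ I.toSubmodule) where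
  smul_bracket k x y := by
    change quotientBracket I (k • x) y = k • quotientBracket I x y
    simp
  bracket_smul k x y := map_smul (quotientBracket I x) k y

theorem quotient_bracket_mk (I : LeibnizIdeal K g) (x y : g) :
    ⁅(Submodule.Quotient.mk x : g ⧸ I.toSubmodule), (Submodule.Quotient.mk y : g ⧸ I.toSubmodule)⁆
      = Submodule.Quotient.mk ⁅x, y⁆ :=
  rfl

variable (K) (g)

/-- The center `Z(g) = {c | [x, c] = 0 = [c, x] for all x}`, a two-sided ideal. -/
def center : LeibnizIdeal K g where
  carrier := {c | ∀ x : g, ⁅x, c⁆ = 0 ∧ ⁅c, x⁆ = 0}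
  zero_mem' x := ⟨map_zero (bracketₗ K x), LinearMap.map_zero₂ (bracketₗ K) x⟩
  add_mem' {a b} ha hb x := by
    rw [LeibnizRing.bracket_add, LeibnizRing.add_bracket, (ha x).1, (ha x).2, (hb x).1, (hb x).2]
    simp
  smul_mem' k a ha x := by
    rw [LeibnizAlgebra.bracket_smul, LeibnizAlgebra.smul_bracket, (ha x).1, (ha x).2]
    simp
  bracket_mem_left a ha x := by
    rw [(ha x).2]
    exact fun y => ⟨map_zero (bracketₗ K y), LinearMap.map_zero₂ (bracketₗ K) y⟩
  bracket_mem_right a ha x := by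
    rw [(ha x).1]
    exact fun y => ⟨map_zero (bracketₗ K y), LinearMap.map_zero₂ (bracketₗ K) y⟩

/-- The commutator `[g, g]`: the subspace spanned by all brackets `[x, y]`. -/
def commutator : Submodule K g :=
  Submodule.span K {z | ∃ x y : g, ⁅x, y⁆ = z}

/-- `g` is perfect if `g = [g, g]`. -/
def IsPerfect : Prop :=
  commutator K g = ⊤

end Basic

/-- `g` is capable if it is isomorphic to `q / Z(q)` for some Leibniz algebra `q`. The universe of
`q` is that of `g` or any larger one. -/
def IsCapable (K : Type u) (g : Type v) [Field K] [LeibnizRing g]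
    [LeibnizAlgebra K g] : Prop :=
  ∃ (q : Type (max v w)) (_ : LeibnizRing q) (_ : LeibnizAlgebra K q),
    Nonempty (LeibnizEquiv K g (q ⧸ (center K q).toSubmodule))

end LeibnizAlgebra

namespace LeibnizAlgebra

section ULift

/-! If the center is zero, `g` is its own quotient by the center, hence capable. Conversely, let `x`
in `q` lift a central element of `q / Z(q) ≅ g`. Brackets of `x` with `q` are central, so by the
Leibniz identity `x` annihilates `[q, q]` on both sides (`bracket_mem_annihilator`). Perfectness of
`g` means `q = [q, q] + Z(q)`, so `x` annihilates `q` and its class is zero. -/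

instance uliftLeibnizRing (g : Type v) [LeibnizRing g] : LeibnizRing (ULift.{w} g) where
  bracket x y := ⟨⁅x.down, y.down⁆⟩
  add_bracket x y z := congrArg ULift.up (LeibnizRing.add_bracket x.down y.down z.down)
  bracket_add x y z := congrArg ULift.up (LeibnizRing.bracket_add x.down y.down z.down)
  leibniz x y z := congrArg ULift.up (LeibnizRing.leibniz x.down y.down z.down)

instance uliftLeibnizAlgebra (K : Type u) (g : Type v) [Field K] [LeibnizRing g]
    [LeibnizAlgebra K g] : LeibnizAlgebra K (ULift.{w} g) where
  smul_bracket k x y := congrArg ULift.up (LeibnizAlgebra.smul_bracket k x.down y.down)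
  bracket_smul k x y := congrArg ULift.up (LeibnizAlgebra.bracket_smul k x.down y.down)

theorem center_ulift_eq_bot {K : Type u} {g : Type v} [Field K] [LeibnizRing g]
    [LeibnizAlgebra K g] (h : (center K g).toSubmodule = ⊥) :
    (center K (ULift.{w} g)).toSubmodule = ⊥ := by
  rw [Submodule.eq_bot_iff] at h ⊢
  intro c hc
  have hc' : c.down ∈ (center K g).toSubmodule := fun x =>
    ⟨congrArg ULift.down (hc ⟨x⟩).1, congrArg ULift.down (hc ⟨x⟩).2⟩
  exact congrArg ULift.up (h _ hc')

end ULift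

section Annihilator

variable (K : Type*) {q : Type*} [Field K] [LeibnizRing q] [LeibnizAlgebra K q]

theorem zero_bracket' (x : q) : ⁅(0 : q), x⁆ = 0 := by
  simpa using LeibnizRing.add_bracket (0 : q) 0 x

theorem bracket_zero' (x : q) : ⁅x, (0 : q)⁆ = 0 := by
  simpa using LeibnizRing.bracket_add x (0 : q) 0

/-- The two-sided annihilator of an element, as a subspace. -/
def annihilator (x : q) : Submodule K q where
  carrier := {y | ⁅x, y⁆ = 0 ∧ ⁅y, x⁆ = 0}
  zero_mem' := ⟨bracket_zero' x, zero_bracket' x⟩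
  add_mem' {a b} ha hb := by
    refine ⟨?_, ?_⟩
    · rw [LeibnizRing.bracket_add, ha.1, hb.1, add_zero]
    · rw [LeibnizRing.add_bracket, ha.2, hb.2, add_zero]
  smul_mem' k a ha := by
    refine ⟨?_, ?_⟩
    · rw [LeibnizAlgebra.bracket_smul, ha.1, smul_zero]
    · rw [LeibnizAlgebra.smul_bracket, ha.2, smul_zero]

variable {K}

theorem center_le_annihilator (x : q) : (center K q).toSubmodule ≤ annihilator K x :=
  fun _ hc => hc x

/-- An element that is central modulo the center annihilates all brackets. -/
theorem bracket_mem_annihilator {x : q}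
    (hx : ∀ y : q, ⁅y, x⁆ ∈ (center K q).toSubmodule ∧ ⁅x, y⁆ ∈ (center K q).toSubmodule)
    (a b : q) : ⁅a, b⁆ ∈ annihilator K x := by
  refine ⟨?_, ?_⟩
  · rw [LeibnizRing.leibniz, ((hx a).2 b).2, ((hx b).2 a).2, sub_zero]
  -- Here `⁅⁅a, b⁆, x⁆` is a term on the right of the identity; the two other terms involve the
  -- central elements `⁅b, x⁆` and `⁅a, x⁆`.
  · have h := LeibnizRing.leibniz a b x
    rw [((hx b).1 a).1, ((hx a).1 b).2, sub_zero] at h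
    exact h.symm

end Annihilator

/-- If `q / Z(q)` is isomorphic to a perfect Leibniz algebra `g`, then `g` has trivial center. -/
theorem center_eq_bot_of_equiv_quotient_center {K g q : Type*} [Field K] [LeibnizRing g]
    [LeibnizAlgebra K g] [LeibnizRing q] [LeibnizAlgebra K q] (hg : IsPerfect K g)
    (f : LeibnizEquiv K g (q ⧸ (center K q).toSubmodule)) :
    (center K g).toSubmodule = ⊥ := by
  set Z := (center K q).toSubmodule
  have hf : ∀ x y : g, f.toLinearEquiv ⁅x, y⁆ = ⁅f.toLinearEquiv x, f.toLinearEquiv y⁆ :=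
    f.map_bracket
  rw [Submodule.eq_bot_iff]
  intro c hc
  obtain ⟨x, hx⟩ := Z.mkQ_surjective (f.toLinearEquiv c)
  have hxZ : ∀ y : q, ⁅y, x⁆ ∈ Z ∧ ⁅x, y⁆ ∈ Z := by
    intro y
    obtain ⟨u, hu⟩ := f.toLinearEquiv.surjective (Z.mkQ y)
    refine ⟨(Submodule.Quotient.mk_eq_zero Z).1 ?_, (Submodule.Quotient.mk_eq_zero Z).1 ?_⟩
    · change ⁅Z.mkQ y, Z.mkQ x⁆ = 0
      rw [hx, ← hu, ← hf, (hc u).1, map_zero]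
    · change ⁅Z.mkQ x, Z.mkQ y⁆ = 0
      rw [hx, ← hu, ← hf, (hc u).2, map_zero]
  -- Perfectness is known for `g`, not for `q`, so the annihilator is transported to a subspace of
  -- `g`, where only brackets need checking.
  have htop : ((annihilator K x).map Z.mkQ).comap f.toLinearEquiv.toLinearMap = ⊤ := by
    rw [eq_top_iff, ← show commutator K g = ⊤ from hg, commutator, Submodule.span_le]
    rintro _ ⟨a, b, rfl⟩
    obtain ⟨a', ha⟩ := Z.mkQ_surjective (f.toLinearEquiv a)
    obtain ⟨b', hb⟩ := Z.mkQ_surjective (f.toLinearEquiv b)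
    refine ⟨⁅a', b'⁆, bracket_mem_annihilator hxZ a' b', ?_⟩
    change ⁅Z.mkQ a', Z.mkQ b'⁆ = f.toLinearEquiv ⁅a, b⁆
    rw [ha, hb, hf]
  have hxc : x ∈ Z := by
    intro y
    suffices y ∈ annihilator K x from ⟨this.2, this.1⟩
    obtain ⟨u, hu⟩ := f.toLinearEquiv.surjective (Z.mkQ y)
    obtain ⟨s, hs, hsu⟩ : f.toLinearEquiv u ∈ (annihilator K x).map Z.mkQ :=
      (Submodule.eq_top_iff'.1 htop u :)
    -- The annihilator contains `Z`, so agreeing with `s` modulo `Z` is enough.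
    have hys : y - s ∈ Z := (Submodule.Quotient.eq Z).1 (hu.symm.trans hsu.symm)
    simpa using add_mem (center_le_annihilator x hys) hs
  rw [← f.toLinearEquiv.map_eq_zero_iff, ← hx]
  exact (Submodule.Quotient.mk_eq_zero Z).2 hxc

/-- A Leibniz algebra with trivial center is capable. -/
theorem isCapable_of_center_eq_bot (K : Type u) (g : Type v) [Field K] [LeibnizRing g]
    [LeibnizAlgebra K g] (h : (center K g).toSubmodule = ⊥) : IsCapable.{u, v, w} K g :=
  -- The lift only places `g` in the universe `max v w` required of `q`.
  ⟨ULift.{w} g, inferInstance, inferInstance,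
    ⟨{ toLinearEquiv := ULift.moduleEquiv.symm.trans
          (Submodule.quotEquivOfEqBot _ (center_ulift_eq_bot h)).symm
       map_bracket := fun _ _ => rfl }⟩⟩

end LeibnizAlgebra

theorem proposition5p1 (K : Type u) (g : Type v) [Field K] [LeibnizRing g]
    [LeibnizAlgebra K g] (hg : LeibnizAlgebra.IsPerfect K g) :
    LeibnizAlgebra.IsCapable.{u, v, w} K g ↔ (LeibnizAlgebra.center K g).toSubmodule = ⊥ :=
  ⟨fun ⟨_, _, _, ⟨f⟩⟩ => LeibnizAlgebra.center_eq_bot_of_equiv_quotient_center hg f,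
    LeibnizAlgebra.isCapable_of_center_eq_bot K g⟩
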